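/- Let $n\ge 1$ and $d\ge 1$ be integers and let $\mathcal H=\mathbb C^d$. A state of a finite-dimensional Hilbert space is a positive semidefinite operator of unit trace; it is pure if it has the form $|\psi\rangle\langle\psi|$ for a unit vector $\psi$. For two states $\rho,\sigma$ of $\mathcal H^{\otimes n}$, the quantum Wasserstein distance of order $1$ is $$\|\rho-\sigma\|_{W_1}=\min\Big\{\sum_{i=1}^n c_i \;:\; c_i\ge 0,\ \ \rho-\sigma=\sum_{i=1}^n c_i\big(\tau^{(i)}-\eta^{(i)}\big),\ \ \tau^{(i)},\eta^{(i)}\text{ states of }\mathcal H^{\otimes n},\ \ \mathrm{Tr}_i\,\tau^{(i)}=\mathrm{Tr}_i\,\eta^{(i)}\Big\},$$ where $\mathrm{Tr}_i$ is the partial trace over the $i$-th tensor factor. Let $h_2(x)=-x\ln x-(1-x)\ln(1-x)$ be the binary entropy function, with the convention $0\ln 0=0$ (which is also used for the term $p\ln(d-1)$ below when $d=1$, in which case $p=0$). Then for all pure states $\phi_1,\dots,\phi_n$ of $\mathcal H$ and every state $\rho$ of $\mathcal H^{\otimes n}$, $$\frac1n\,\big\|\rho-\phi_1\otimes\cdots\otimes\phi_n\big\|_{W_1}\;\le\;\sqrt{\frac{h_2(p)+p\ln(d-1)}{2}}+p,\qquad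 p=\frac1n\sum_{i=1}^n\big(1-\mathrm{Tr}[\rho_i\phi_i]\big),$$ where $\rho_i$ is the marginal of $\rho$ on the $i$-th tensor factor, i.e. the partial trace of $\rho$ over all the other factors; $p$ is the average infidelity between the $\rho_i$ and the $\phi_i$. -/

import Mathlib

open scoped ComplexOrder

/-- Density matrices (mixed states): positive semidefinite complex matrices of unit trace. -/
def IsDensityMatrix {m : Type*} [Fintype m] (ρ : Matrix m m ℂ) : Prop :=
  ρ.PosSemidef ∧ ρ.trace = 1

/-- Pure states `|ψ⟩⟨ψ|` with `ψ` a unit vector. -/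
def IsPureState {m : Type*} [Fintype m] (φ : Matrix m m ℂ) : Prop :=
  ∃ ψ : EuclideanSpace ℂ m, ‖ψ‖ = 1 ∧ φ = Matrix.of fun a b => ψ a * star (ψ b)

/-- Operators on `(ℂ^d)^{⊗ n}`, in the product basis, which is indexed by `Fin n → Fin d`. -/
abbrev MultiOp (n d : ℕ) : Type := Matrix (Fin n → Fin d) (Fin n → Fin d) ℂ

/-- The tensor product `φ 0 ⊗ ⋯ ⊗ φ (n - 1)`. -/
def tensorProductOp {n d : ℕ} (φ : Fin n → Matrix (Fin d) (Fin d) ℂ) : MultiOp n d :=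
  Matrix.of fun x y => ∏ i, φ i (x i) (y i)

/-- The string with symbol `a` at site `i` and with the symbols `z` at all other sites. -/
def glueSite {n d : ℕ} (i : Fin n) (a : Fin d) (z : {j : Fin n // j ≠ i} → Fin d) :
    Fin n → Fin d :=
  (Equiv.funSplitAt i (Fin d)).symm (a, z)

/-- The partial trace over the single site `i`: the system that remains consists of all the
other sites. -/
def traceOut {n d : ℕ} (i : Fin n) (ρ : MultiOp n d) :
    Matrix ({j : Fin n // j ≠ i} → Fin d) ({j : Fin n // j ≠ i} → Fin d) ℂ :=
  Matrix.of fun z w => ∑ a : Fin d, ρ (glueSite i a z) (glueSite i a w)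

/-- The marginal at site `i`: the partial trace over all the other sites. -/
def marginal {n d : ℕ} (i : Fin n) (ρ : MultiOp n d) : Matrix (Fin d) (Fin d) ℂ :=
  Matrix.of fun a b => ∑ z : {j : Fin n // j ≠ i} → Fin d, ρ (glueSite i a z) (glueSite i b z)

/-- The costs `∑ i, c i` of all decompositions `ρ - σ = ∑ i, c i • (τ i - η i)` with `c i ≥ 0`
and with states `τ i`, `η i` that coincide when site `i` is discarded. -/
def wassersteinCosts {n d : ℕ} (ρ σ : MultiOp n d) : Set ℝ :=
  {w | ∃ (c : Fin n → ℝ) (τ η : Fin n → MultiOp n d),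
    (∀ i, 0 ≤ c i) ∧
    (∀ i, IsDensityMatrix (τ i) ∧ IsDensityMatrix (η i) ∧ traceOut i (τ i) = traceOut i (η i)) ∧
    ρ - σ = ∑ i, (c i : ℂ) • (τ i - η i) ∧
    w = ∑ i, c i}

/-- The quantum Wasserstein distance of order 1 (`‖ρ - σ‖_{W₁}`) between two states: the least
cost of a decomposition. -/
noncomputable def wassersteinDist {n d : ℕ} (ρ σ : MultiOp n d) : ℝ :=
  sInf (wassersteinCosts ρ σ)

/-- The average infidelity `(1 / n) ∑ i, (1 - Tr[ρ_i φ_i])`. -/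
noncomputable def avgInfidelity {n d : ℕ} (ρ : MultiOp n d)
    (φ : Fin n → Matrix (Fin d) (Fin d) ℂ) : ℝ :=
  (1 / (n : ℝ)) * ∑ i, (1 - (marginal i ρ * φ i).trace.re)

section WellDefined

open scoped Matrix.Norms.L2Operator MatrixOrder in
theorem exists_shift_posSemidef {m : Type*} [Fintype m] [DecidableEq m] (Y : Matrix m m ℂ)
    (h : Y.IsHermitian) : ∃ k : ℝ, 0 ≤ k ∧ (Y + (k : ℂ) • (1 : Matrix m m ℂ)).PosSemidef := by
  refine ⟨‖Y‖, norm_nonneg _, ?_⟩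
  have h1 := IsSelfAdjoint.neg_algebraMap_norm_le_self (a := Y) h
  rw [Matrix.le_iff] at h1
  have e : Y + ((‖Y‖ : ℝ) : ℂ) • (1 : Matrix m m ℂ) = Y - -(algebraMap ℝ (Matrix m m ℂ)) ‖Y‖ := by
    rw [sub_neg_eq_add, Algebra.algebraMap_eq_smul_one]
    ext
    simp
  rw [e]
  exact h1

theorem glueSite_eq_update {n d : ℕ} (i : Fin n) (a : Fin d) (x : Fin n → Fin d) :
    glueSite i a (fun j => x j) = Function.update x i a := by
  funext j
  by_cases h : j = i
  · subst h; simp [glueSite, Equiv.funSplitAt]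
  · simp [glueSite, Equiv.funSplitAt, h]

theorem update_glueSite {n d : ℕ} (i : Fin n) (a b : Fin d) (z : {j : Fin n // j ≠ i} → Fin d) :
    Function.update (glueSite i a z) i b = glueSite i b z := by
  funext j
  by_cases h : j = i
  · subst h; simp [glueSite, Equiv.funSplitAt]
  · simp [glueSite, Equiv.funSplitAt, h]

theorem glueSite_self {n d : ℕ} (i : Fin n) (a : Fin d) (z : {j : Fin n // j ≠ i} → Fin d) :
    glueSite i a z i = a := by
  simp [glueSite, Equiv.funSplitAt]

/-- Replacing site `i` by the maximally mixed state. -/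
noncomputable def depolarise {n d : ℕ} (i : Fin n) (X : MultiOp n d) : MultiOp n d :=
  Matrix.of fun x y => if x i = y i then
    (d : ℂ)⁻¹ * ∑ a, X (Function.update x i a) (Function.update y i a) else 0

theorem traceOut_depolarise {n d : ℕ} (hd : d ≠ 0) (i : Fin n) (X : MultiOp n d) :
    traceOut i (depolarise i X) = traceOut i X := by
  have hd' : (d : ℂ) ≠ 0 := by exact_mod_cast hd
  ext z w
  simp [traceOut, depolarise, update_glueSite, glueSite_self, hd']

theorem trace_eq_trace_traceOut {n d : ℕ} (i : Fin n) (X : MultiOp n d) :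
    X.trace = (traceOut i X).trace := by
  simp only [Matrix.trace, Matrix.diag, traceOut, Matrix.of_apply]
  rw [Finset.sum_comm, ← Fintype.sum_prod_type' (f := fun a z => X (glueSite i a z) (glueSite i a z))]
  exact (Equiv.sum_comp (Equiv.funSplitAt i (Fin d)).symm (fun x => X x x)).symm

theorem depolarise_isHermitian {n d : ℕ} (i : Fin n) {X : MultiOp n d} (h : X.IsHermitian) :
    (depolarise i X).IsHermitian := by
  ext x y
  simp only [Matrix.conjTranspose_apply, depolarise, Matrix.of_apply]
  by_cases hxy : x i = y i
  · simp [hxy, h.apply]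
  · simp [hxy, Ne.symm hxy]

theorem depolarise_comm {n d : ℕ} (i j : Fin n) (X : MultiOp n d) :
    depolarise i (depolarise j X) = depolarise j (depolarise i X) := by
  by_cases hij : i = j
  · rw [hij]
  ext x y
  simp only [depolarise, Matrix.of_apply, Function.update_of_ne hij,
    Function.update_of_ne (Ne.symm hij)]
  by_cases h1 : x i = y i <;> by_cases h2 : x j = y j <;> simp [h1, h2]
  simp only [← Finset.mul_sum]
  rw [Finset.sum_comm]
  simp only [Function.update_comm hij]
  exact Or.inl trivial

theorem depolarise_idem {n d : ℕ} (hd : d ≠ 0) (i : Fin n) (X : MultiOp n d) :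
    depolarise i (depolarise i X) = depolarise i X := by
  have hd' : (d : ℂ) ≠ 0 := by exact_mod_cast hd
  ext x y
  by_cases h : x i = y i
  · simp [depolarise, h, hd']
  · simp [depolarise, h]

/-- Depolarising all the sites in a list. -/
noncomputable def depolariseList {n d : ℕ} (l : List (Fin n)) (X : MultiOp n d) : MultiOp n d :=
  l.foldr depolarise X

theorem depolarise_depolariseList {n d : ℕ} (hd : d ≠ 0) (l : List (Fin n)) (X : MultiOp n d)
    (i : Fin n) (hi : i ∈ l) : depolarise i (depolariseList l X) = depolariseList l X := by
  induction l with
  | nil => simp at hi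
  | cons j l ih =>
    change depolarise i (depolarise j (depolariseList l X)) = depolarise j (depolariseList l X)
    rcases List.mem_cons.1 hi with rfl | h
    · exact depolarise_idem hd _ _
    · rw [depolarise_comm, ih h]

theorem depolariseList_spec {n d : ℕ} (hd : d ≠ 0) (l : List (Fin n)) (hl : l.Nodup)
    (X : MultiOp n d) (h : X.IsHermitian) :
    (depolariseList l X).IsHermitian ∧ (depolariseList l X).trace = X.trace ∧
    ∃ Y : Fin n → MultiOp n d, (∀ i, (Y i).IsHermitian ∧ traceOut i (Y i) = 0) ∧
      (∀ i, i ∉ l → Y i = 0) ∧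
      X - depolariseList l X = ∑ i, Y i := by
  induction l with
  | nil => exact ⟨h, rfl, fun _ => 0, fun i => ⟨Matrix.isHermitian_zero, by ext; simp [traceOut]⟩,
      fun _ _ => rfl, by simp [depolariseList]⟩
  | cons j l ih =>
    obtain ⟨hj, hl⟩ := List.nodup_cons.1 hl
    obtain ⟨h1, h2, Y, h3, h4, h5⟩ := ih hl
    have e : depolariseList (j :: l) X = depolarise j (depolariseList l X) := rfl
    rw [e]
    refine ⟨depolarise_isHermitian j h1, ?_, Function.update Y j
      (depolariseList l X - depolarise j (depolariseList l X)), ?_, ?_, ?_⟩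
    · rw [trace_eq_trace_traceOut j, traceOut_depolarise hd, ← trace_eq_trace_traceOut, h2]
    · intro i
      by_cases hi : i = j
      · subst hi
        rw [Function.update_self]
        refine ⟨h1.sub (depolarise_isHermitian i h1), ?_⟩
        have h6 := traceOut_depolarise hd i (depolariseList l X)
        ext z w
        have h7 := congrFun (congrFun h6 z) w
        simp only [traceOut, Matrix.of_apply] at h7
        simp [traceOut, h7]
      · rw [Function.update_of_ne hi]
        exact h3 i
    · intro i hi
      rw [List.mem_cons, not_or] at hi
      rw [Function.update_of_ne hi.1, h4 i hi.2]
    · rw [Finset.sum_update_of_mem (Finset.mem_univ j)]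
      have h6 := Finset.sum_sdiff (f := Y) (Finset.subset_univ {j})
      rw [Finset.sum_singleton, h4 j hj, add_zero, ← h5] at h6
      rw [h6]
      abel

theorem eq_zero_of_depolarise_eq {n d : ℕ} (hd : d ≠ 0) (X : MultiOp n d)
    (h : ∀ i, depolarise i X = X) (ht : X.trace = 0) : X = 0 := by
  have hd' : (d : ℂ) ≠ 0 := by exact_mod_cast hd
  have off : ∀ x y, x ≠ y → X x y = 0 := by
    intro x y hxy
    obtain ⟨i, hi⟩ := Function.ne_iff.1 hxy
    rw [← h i]
    simp [depolarise, hi]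
  have upd : ∀ x i a, X (Function.update x i a) (Function.update x i a) = X x x := by
    intro x i a
    rw [← h i]
    simp [depolarise]
  have const : ∀ x y, X x x = X y y := by
    intro x y
    have key : ∀ s : Finset (Fin n), ∃ z : Fin n → Fin d, X z z = X x x ∧
        ∀ i ∈ s, z i = y i := by
      intro s
      induction s using Finset.induction_on with
      | empty => exact ⟨x, rfl, by simp⟩
      | insert i s hi ih =>
        obtain ⟨z, hz, hz'⟩ := ih
        refine ⟨Function.update z i (y i), by rw [upd, hz], ?_⟩
        intro j hj
        by_cases hji : j = i
        · subst hji; simp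
        · rw [Function.update_of_ne hji]
          exact hz' j ((Finset.mem_insert.1 hj).resolve_left hji)
    obtain ⟨z, hz, hz'⟩ := key Finset.univ
    rw [← hz, show z = y from funext fun i => hz' i (Finset.mem_univ i)]
  ext x y
  by_cases hxy : x = y
  · subst hxy
    have h1 : X.trace = ∑ _ : Fin n → Fin d, X x x :=
      Finset.sum_congr rfl fun y _ => const y x
    rw [ht] at h1
    simp [hd] at h1
    exact h1
  · exact off x y hxy

theorem wassersteinCosts_nonempty {n d : ℕ} (ρ σ : MultiOp n d) (hρ : IsDensityMatrix ρ)
    (hσ : IsDensityMatrix σ) : (wassersteinCosts ρ σ).Nonempty := by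
  by_cases hd : d ^ n = 0
  · exfalso
    have h1 : IsEmpty (Fin n → Fin d) := by
      rw [← Fintype.card_eq_zero_iff]
      simpa using hd
    have h2 := hρ.2
    simp [Matrix.trace] at h2
  rcases Nat.eq_zero_or_pos n with rfl | hn
  · refine ⟨0, 0, 0, 0, by simp, fun i => i.elim0, ?_, by simp⟩
    have h1 := hρ.2
    have h2 := hσ.2
    simp only [Matrix.trace, Finset.univ_unique, Finset.sum_singleton, Matrix.diag] at h1 h2
    ext x y
    rw [Subsingleton.elim x default, Subsingleton.elim y default]
    simp [h1, h2]
  have hd0 : d ≠ 0 := by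
    rintro rfl
    exact hd (zero_pow hn.ne')
  have hN : (0 : ℝ) < (d : ℝ) ^ n := by positivity
  have hNc : ((d : ℂ) ^ n) ≠ 0 := by exact_mod_cast hd
  obtain ⟨-, h2, Y, h3, -, h5⟩ := depolariseList_spec hd0 (List.finRange n)
    (List.nodup_finRange n) (ρ - σ) (hρ.1.isHermitian.sub hσ.1.isHermitian)
  have h6 : depolariseList (List.finRange n) (ρ - σ) = 0 := by
    apply eq_zero_of_depolarise_eq hd0
    · exact fun i => depolarise_depolariseList hd0 _ _ i (List.mem_finRange i)
    · rw [h2, Matrix.trace_sub, hρ.2, hσ.2, sub_self]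
  rw [h6, sub_zero] at h5
  have hpos : ∀ i, ∃ k : ℝ, 0 < k ∧ (Y i + (k : ℂ) • (1 : MultiOp n d)).PosSemidef := by
    intro i
    obtain ⟨k, hk, hk'⟩ := exists_shift_posSemidef (Y i) (h3 i).1
    refine ⟨k + 1, by linarith, ?_⟩
    have e : Y i + ((k + 1 : ℝ) : ℂ) • (1 : MultiOp n d)
        = (Y i + (k : ℂ) • (1 : MultiOp n d)) + 1 := by
      push_cast
      rw [add_smul, one_smul, add_assoc]
    rw [e]
    exact hk'.add Matrix.PosSemidef.one
  choose k hk hk' using hpos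
  have hc : ∀ i, (0 : ℝ) ≤ (k i * (d : ℝ) ^ n)⁻¹ := fun i => by
    have := hk i
    positivity
  have hcc : ∀ i, (0 : ℂ) ≤ (((k i * (d : ℝ) ^ n)⁻¹ : ℝ) : ℂ) := fun i => by
    exact_mod_cast hc i
  have hkc : ∀ i, (k i : ℂ) ≠ 0 := fun i => by exact_mod_cast (hk i).ne'
  have htr : ∀ i, (Y i).trace = 0 := fun i => by
    rw [trace_eq_trace_traceOut i, (h3 i).2, Matrix.trace_zero]
  have htr1 : (1 : MultiOp n d).trace = (d : ℂ) ^ n := by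
    simp [Matrix.trace_one]
  refine ⟨_, fun i => k i * (d : ℝ) ^ n,
    fun i => (((k i * (d : ℝ) ^ n)⁻¹ : ℝ) : ℂ) • (Y i + (k i : ℂ) • (1 : MultiOp n d)),
    fun i => (((k i * (d : ℝ) ^ n)⁻¹ : ℝ) : ℂ) • ((k i : ℂ) • (1 : MultiOp n d)),
    fun i => (mul_pos (hk i) hN).le, fun i => ⟨⟨?_, ?_⟩, ⟨?_, ?_⟩, ?_⟩, ?_, rfl⟩
  · exact (hk' i).smul (hcc i)
  · rw [Matrix.trace_smul, Matrix.trace_add, htr, Matrix.trace_smul, htr1, zero_add]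
    push_cast
    have := hkc i
    simp only [smul_eq_mul]
    field_simp
  · refine (Matrix.PosSemidef.one.smul ?_).smul (hcc i)
    exact_mod_cast (hk i).le
  · rw [Matrix.trace_smul, Matrix.trace_smul, htr1]
    push_cast
    have := hkc i
    simp only [smul_eq_mul]
    field_simp
  · ext z w
    have h7 := congrFun (congrFun (h3 i).2 z) w
    simp only [traceOut, Matrix.of_apply, Matrix.zero_apply] at h7
    simp only [traceOut, Matrix.of_apply, Matrix.smul_apply, Matrix.add_apply, smul_eq_mul,
      mul_add, Finset.sum_add_distrib, ← Finset.mul_sum]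
    rw [h7, mul_zero, zero_add]
  · rw [h5]
    refine Finset.sum_congr rfl fun i _ => ?_
    rw [← smul_sub, add_sub_cancel_right, smul_smul]
    push_cast
    have := hkc i
    rw [mul_inv_cancel₀ (by positivity), one_smul]

theorem norm_le_one_of_isDensityMatrix {m : Type*} [Fintype m] {ρ : Matrix m m ℂ}
    (h : IsDensityMatrix ρ) (x y : m) : ‖ρ x y‖ ≤ 1 := by
  have hdiag : ∀ x, 0 ≤ ρ x x := fun x => h.1.diag_nonneg
  have hle : ∀ x, ρ x x ≤ 1 := fun x => by
    rw [← h.2]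
    exact Finset.single_le_sum (f := fun x => ρ x x) (fun x _ => hdiag x) (Finset.mem_univ x)
  have h1 := (h.1.submatrix ![x, y]).det_nonneg
  rw [Matrix.det_fin_two] at h1
  simp only [Matrix.submatrix_apply, Matrix.cons_val_zero, Matrix.cons_val_one] at h1
  rw [← h.1.isHermitian.apply y x, Complex.star_def, Complex.mul_conj, sub_nonneg] at h1
  have h2 : ρ x x * ρ y y ≤ 1 := by
    calc ρ x x * ρ y y ≤ 1 * 1 := mul_le_mul (hle x) (hle y) (hdiag y) zero_le_one
      _ = 1 := one_mul 1
  have h3 : Complex.normSq (ρ x y) ≤ 1 := by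
    have := h1.trans h2
    exact_mod_cast this
  rw [Complex.normSq_eq_norm_sq] at h3
  nlinarith [norm_nonneg (ρ x y)]

theorem isCompact_densityMatrices {m : Type*} [Fintype m] :
    IsCompact {ρ : Matrix m m ℂ | IsDensityMatrix ρ} := by
  have : T2Space (Matrix m m ℂ) := inferInstanceAs (T2Space (m → m → ℂ))
  have hK : IsCompact (X := Matrix m m ℂ) (Set.univ.pi fun _ : m => Set.univ.pi fun _ : m =>
      Metric.closedBall (0 : ℂ) 1) :=
    isCompact_univ_pi fun _ => isCompact_univ_pi fun _ => isCompact_closedBall _ _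
  refine hK.of_isClosed_subset ?_ ?_
  · have e : {ρ : Matrix m m ℂ | IsDensityMatrix ρ} =
        {ρ | ρ.conjTranspose = ρ} ∩ (⋂ v : m → ℂ, {ρ | 0 ≤ star v ⬝ᵥ (ρ.mulVec v)}) ∩
          {ρ | ρ.trace = 1} := by
      ext ρ
      simp [IsDensityMatrix, Matrix.posSemidef_iff_dotProduct_mulVec, Matrix.IsHermitian]
    rw [e]
    refine IsClosed.inter (IsClosed.inter ?_ (isClosed_iInter fun v => ?_)) ?_
    · exact isClosed_eq (by fun_prop) continuous_id
    · refine isClosed_le continuous_const ?_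
      fun_prop
    · exact isClosed_eq (by fun_prop) continuous_const
  · intro ρ h
    exact fun x _ y _ => mem_closedBall_zero_iff.2 (norm_le_one_of_isDensityMatrix h x y)

/-- The minimum that defines the distance between two states exists and is attained. -/
theorem isLeast_wassersteinDist {n d : ℕ} {ρ σ : MultiOp n d} (hρ : IsDensityMatrix ρ)
    (hσ : IsDensityMatrix σ) : IsLeast (wassersteinCosts ρ σ) (wassersteinDist ρ σ) := by
  obtain ⟨w₀, hw₀⟩ := wassersteinCosts_nonempty ρ σ hρ hσ
  have hbdd : BddBelow (wassersteinCosts ρ σ) := by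
    refine ⟨0, ?_⟩
    rintro w ⟨c, τ, η, hc, -, -, rfl⟩
    exact Finset.sum_nonneg fun i _ => hc i
  let P : Set ((Fin n → ℝ) × (Fin n → MultiOp n d) × (Fin n → MultiOp n d)) :=
    ((Set.univ.pi fun _ => Set.Icc 0 w₀) ×ˢ
      ((Set.univ.pi fun _ => {ρ | IsDensityMatrix ρ}) ×ˢ
        (Set.univ.pi fun _ => {ρ | IsDensityMatrix ρ})))
  have hP : IsCompact P := (isCompact_univ_pi fun _ => isCompact_Icc).prod
    ((isCompact_univ_pi fun _ => isCompact_densityMatrices).prod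
      (isCompact_univ_pi fun _ => isCompact_densityMatrices))
  let Q : Set ((Fin n → ℝ) × (Fin n → MultiOp n d) × (Fin n → MultiOp n d)) :=
    (⋂ i, {q | traceOut i (q.2.1 i) = traceOut i (q.2.2 i)}) ∩
      {q | ρ - σ = ∑ i, (q.1 i : ℂ) • (q.2.1 i - q.2.2 i)}
  have hQ : IsClosed Q := by
    refine IsClosed.inter (isClosed_iInter fun i => isClosed_eq ?_ ?_)
      (isClosed_eq continuous_const ?_)
    · refine continuous_matrix fun z w => ?_
      simp only [traceOut, Matrix.of_apply]
      fun_prop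
    · refine continuous_matrix fun z w => ?_
      simp only [traceOut, Matrix.of_apply]
      fun_prop
    · fun_prop
  have hS : IsCompact ((fun q : (Fin n → ℝ) × (Fin n → MultiOp n d) × (Fin n → MultiOp n d) =>
      ∑ i, q.1 i) '' (P ∩ Q)) := (hP.inter_right hQ).image (by fun_prop)
  have hsub : (fun q : (Fin n → ℝ) × (Fin n → MultiOp n d) × (Fin n → MultiOp n d) =>
      ∑ i, q.1 i) '' (P ∩ Q) ⊆ wassersteinCosts ρ σ := by
    rintro w ⟨⟨c, τ, η⟩, ⟨⟨h1, h2, h3⟩, h4, h5⟩, rfl⟩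
    refine ⟨c, τ, η, fun i => (h1 i trivial).1, fun i => ⟨h2 i trivial, h3 i trivial, ?_⟩, h5, rfl⟩
    exact Set.mem_iInter.1 h4 i
  have hmem : ∀ w ∈ wassersteinCosts ρ σ, w ≤ w₀ →
      w ∈ (fun q : (Fin n → ℝ) × (Fin n → MultiOp n d) × (Fin n → MultiOp n d) =>
      ∑ i, q.1 i) '' (P ∩ Q) := by
    rintro w ⟨c, τ, η, hc, h1, h2, rfl⟩ hw
    refine ⟨(c, τ, η), ⟨⟨fun i _ => ⟨hc i, ?_⟩, fun i _ => (h1 i).1, fun i _ => (h1 i).2.1⟩,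
      Set.mem_iInter.2 fun i => (h1 i).2.2, h2⟩, rfl⟩
    exact (Finset.single_le_sum (fun j _ => hc j) (Finset.mem_univ i)).trans hw
  obtain ⟨w, hw, hmin⟩ := hS.exists_isLeast ⟨w₀, hmem w₀ hw₀ le_rfl⟩
  have hleast : IsLeast (wassersteinCosts ρ σ) w := by
    refine ⟨hsub hw, fun v hv => ?_⟩
    rcases le_total v w₀ with h | h
    · exact hmin (hmem v hv h)
    · exact (hmin (hmem w₀ hw₀ le_rfl)).trans h
  rw [wassersteinDist, hleast.csInf_eq]
  exact hleast

end WellDefined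

/-! ### Product operators, single-site operators and their traces. -/

section TensorProduct

/-! Replace the sites of `ρ` one after another by the pure states `φ i`. The differences of
successive states telescope to `ρ - tensorProductOp φ` (`sub_tensorProductOp_eq_sum`), and the
`i`-th difference vanishes when site `i` is discarded, so it is an admissible term of a
decomposition.

The price of one replacement is found in `exists_decomposition_sub_replaceSite`. Let `P` be the
projection `φ i` at site `i`, `Q = 1 - P`, and `q` the overlap of the marginal with `φ i`.
Replacement fixes the block `P X P` and kills the off-diagonal blocks (`sub_replaceSite_eq`). The
off-diagonal part is, by polarisation, a difference of two positive operators with a free parameter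
`t > 0`; together with the `Q X Q` terms the cost is `(t q + (1 - q) / t) / 2 + (1 - q)`. Earlier
replacements leave the marginal at site `i` intact, so `q` is the overlap for `ρ` itself.

With one `t` for all sites the cost is affine in `q`, so averaging yields the same expression in the
average infidelity `p`. Optimising `t` gives the dimension-free bound `√(p (1 - p)) + p`. The
entropic bound is weaker, because `2 p (1 - p)` is at most the binary entropy and the term with `log
(d - 1)` is nonnegative. -/

theorem tensorProductOp_mul {n d : ℕ} (M N : Fin n → Matrix (Fin d) (Fin d) ℂ) :
    tensorProductOp M * tensorProductOp N = tensorProductOp fun i => M i * N i := by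
  ext x y
  simp only [tensorProductOp, Matrix.mul_apply, Matrix.of_apply, ← Finset.prod_mul_distrib]
  rw [Finset.prod_univ_sum, Fintype.piFinset_univ]

theorem trace_tensorProductOp {n d : ℕ} (M : Fin n → Matrix (Fin d) (Fin d) ℂ) :
    (tensorProductOp M).trace = ∏ i, (M i).trace := by
  simp only [tensorProductOp, Matrix.trace, Matrix.diag, Matrix.of_apply]
  rw [Finset.prod_univ_sum, Fintype.piFinset_univ]

theorem conjTranspose_tensorProductOp {n d : ℕ} (M : Fin n → Matrix (Fin d) (Fin d) ℂ) :
    (tensorProductOp M).conjTranspose = tensorProductOp fun i => (M i).conjTranspose := by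
  ext x y
  simp [tensorProductOp, Matrix.conjTranspose_apply]

theorem tensorProductOp_one {n d : ℕ} :
    tensorProductOp (fun _ : Fin n => (1 : Matrix (Fin d) (Fin d) ℂ)) = 1 := by
  ext x y
  by_cases h : x = y
  · subst h; simp [tensorProductOp]
  · obtain ⟨i, hi⟩ := Function.ne_iff.1 h
    rw [Matrix.one_apply_ne h]
    exact Finset.prod_eq_zero (Finset.mem_univ i) (Matrix.one_apply_ne hi)

/-- Matrices are determined by their pairings with product operators. -/
theorem eq_of_trace_mul_tensorProductOp {n d : ℕ} {X Y : MultiOp n d}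
    (h : ∀ M, (X * tensorProductOp M).trace = (Y * tensorProductOp M).trace) : X = Y := by
  have key : ∀ (Z : MultiOp n d) (x y : Fin n → Fin d),
      (Z * tensorProductOp fun i => Matrix.single (y i) (x i) (1 : ℂ)).trace = Z x y := by
    intro Z x y
    -- A product of matrix units is a matrix unit of the whole space, so these pairings read off
    -- single entries.
    have e : (tensorProductOp fun i => Matrix.single (y i) (x i) (1 : ℂ)) =
        Matrix.single y x (1 : ℂ) := by
      ext u v
      simp only [tensorProductOp, Matrix.of_apply, Matrix.single_apply]
      rw [Finset.prod_ite_zero]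
      simp [funext_iff, forall_and]
    rw [e, Matrix.trace_mul_single]
    simp
  ext x y
  rw [← key X, ← key Y, h]

/-- The operator `M` acting on site `i`. -/
noncomputable def siteOp {n d : ℕ} (i : Fin n) (M : Matrix (Fin d) (Fin d) ℂ) : MultiOp n d :=
  tensorProductOp (Function.update (fun _ => 1) i M)

theorem siteOp_mul {n d : ℕ} (i : Fin n) (M N : Matrix (Fin d) (Fin d) ℂ) :
    siteOp i M * siteOp i N = siteOp i (M * N) := by
  rw [siteOp, siteOp, siteOp, tensorProductOp_mul]
  congr 1
  funext j
  by_cases h : j = i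
  · subst h; simp
  · simp [h]

theorem conjTranspose_siteOp {n d : ℕ} (i : Fin n) (M : Matrix (Fin d) (Fin d) ℂ) :
    (siteOp i M).conjTranspose = siteOp i M.conjTranspose := by
  rw [siteOp, siteOp, conjTranspose_tensorProductOp]
  congr 1
  funext j
  by_cases h : j = i
  · subst h; simp
  · simp [h]

theorem sum_eq_sum_glueSite {n d : ℕ} (i : Fin n) (f : (Fin n → Fin d) → ℂ) :
    ∑ x, f x = ∑ z, ∑ a, f (glueSite i a z) := by
  rw [Finset.sum_comm, ← Fintype.sum_prod_type' (f := fun a z => f (glueSite i a z))]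
  exact (Equiv.sum_comp (Equiv.funSplitAt i (Fin d)).symm f).symm

theorem glueSite_of_ne {n d : ℕ} (i : Fin n) (a : Fin d) (z : {j : Fin n // j ≠ i} → Fin d)
    (j : {j : Fin n // j ≠ i}) : glueSite i a z j = z j := by
  simp [glueSite, Equiv.funSplitAt, j.2]

theorem tensorProductOp_glueSite {n d : ℕ} (i : Fin n) (M : Fin n → Matrix (Fin d) (Fin d) ℂ)
    (a b : Fin d) (z w : {j : Fin n // j ≠ i} → Fin d) :
    tensorProductOp M (glueSite i a z) (glueSite i b w) =
      M i a b * ∏ j : {j : Fin n // j ≠ i}, M j (z j) (w j) := by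
  simp only [tensorProductOp, Matrix.of_apply]
  rw [Fintype.prod_eq_mul_prod_subtype_ne _ i]
  simp only [glueSite_self, glueSite_of_ne]

theorem siteOp_glueSite {n d : ℕ} (i : Fin n) (M : Matrix (Fin d) (Fin d) ℂ)
    (a b : Fin d) (z w : {j : Fin n // j ≠ i} → Fin d) :
    siteOp i M (glueSite i a z) (glueSite i b w) = if z = w then M a b else 0 := by
  rw [siteOp, tensorProductOp_glueSite, Function.update_self]
  have e : ∏ j : {j : Fin n // j ≠ i}, (Function.update (fun _ => 1) i M :
      Fin n → Matrix (Fin d) (Fin d) ℂ) j (z j) (w j) = if z = w then 1 else 0 := by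
    have h : ∀ j : {j : Fin n // j ≠ i}, (Function.update (fun _ => 1) i M :
        Fin n → Matrix (Fin d) (Fin d) ℂ) j = 1 := fun j => Function.update_of_ne j.2 _ _
    simp only [h, Matrix.one_apply]
    rw [Finset.prod_ite_zero]
    simp [funext_iff]
  rw [e]
  simp

theorem exists_glueSite_eq {n d : ℕ} (i : Fin n) (x : Fin n → Fin d) :
    ∃ a z, x = glueSite i a z :=
  ⟨x i, fun j => x j, by rw [glueSite_eq_update, Function.update_eq_self]⟩

theorem mul_siteOp_apply {n d : ℕ} (i : Fin n) (M : Matrix (Fin d) (Fin d) ℂ) (X : MultiOp n d)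
    (x y : Fin n → Fin d) :
    (X * siteOp i M) x y = ∑ b, X x (Function.update y i b) * M b (y i) := by
  obtain ⟨c, w, rfl⟩ := exists_glueSite_eq i y
  rw [Matrix.mul_apply, sum_eq_sum_glueSite i]
  simp [siteOp_glueSite, update_glueSite, glueSite_self]

theorem siteOp_mul_apply {n d : ℕ} (i : Fin n) (M : Matrix (Fin d) (Fin d) ℂ) (X : MultiOp n d)
    (x y : Fin n → Fin d) :
    (siteOp i M * X) x y = ∑ b, M (x i) b * X (Function.update x i b) y := by
  obtain ⟨c, w, rfl⟩ := exists_glueSite_eq i x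
  rw [Matrix.mul_apply, sum_eq_sum_glueSite i]
  simp [siteOp_glueSite, update_glueSite, glueSite_self]

theorem trace_mul_siteOp {n d : ℕ} (i : Fin n) (M : Matrix (Fin d) (Fin d) ℂ) (X : MultiOp n d) :
    (X * siteOp i M).trace = (marginal i X * M).trace := by
  simp only [Matrix.trace, Matrix.diag, mul_siteOp_apply]
  rw [sum_eq_sum_glueSite i]
  simp only [update_glueSite, glueSite_self, Matrix.mul_apply, marginal, Matrix.of_apply,
    Finset.sum_mul]
  rw [Finset.sum_comm]
  exact Finset.sum_congr rfl fun a _ => Finset.sum_comm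

end TensorProduct

/-! ### The discard-and-prepare map at one site. -/

section ReplaceSite

/-- Discarding site `i` and preparing it in the state `φ`. -/
noncomputable def replaceSite {n d : ℕ} (i : Fin n) (φ : Matrix (Fin d) (Fin d) ℂ)
    (X : MultiOp n d) : MultiOp n d :=
  Matrix.of fun x y => φ (x i) (y i) *
    ∑ a, X (Function.update x i a) (Function.update y i a)

theorem replaceSite_add {n d : ℕ} (i : Fin n) (φ : Matrix (Fin d) (Fin d) ℂ) (X Y : MultiOp n d) :
    replaceSite i φ (X + Y) = replaceSite i φ X + replaceSite i φ Y := by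
  ext x y
  simp [replaceSite, Finset.sum_add_distrib, mul_add]

theorem replaceSite_zero {n d : ℕ} (i : Fin n) (φ : Matrix (Fin d) (Fin d) ℂ) :
    replaceSite i φ (0 : MultiOp n d) = 0 := by
  ext x y
  simp [replaceSite]

theorem traceOut_replaceSite {n d : ℕ} (i : Fin n) {φ : Matrix (Fin d) (Fin d) ℂ}
    (hφ : φ.trace = 1) (X : MultiOp n d) : traceOut i (replaceSite i φ X) = traceOut i X := by
  ext z w
  simp only [traceOut, replaceSite, update_glueSite, glueSite_self, Matrix.of_apply,
    ← Finset.sum_mul]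
  rw [show ∑ a, φ a a = 1 from hφ, one_mul]

theorem trace_replaceSite {n d : ℕ} (i : Fin n) {φ : Matrix (Fin d) (Fin d) ℂ}
    (hφ : φ.trace = 1) (X : MultiOp n d) : (replaceSite i φ X).trace = X.trace := by
  rw [trace_eq_trace_traceOut i, traceOut_replaceSite i hφ, ← trace_eq_trace_traceOut]

/-- The partial trace is cyclic with respect to operators on the discarded site. This is what kills
the off-diagonal blocks. -/
theorem replaceSite_siteOp_mul {n d : ℕ} (i : Fin n) (φ M : Matrix (Fin d) (Fin d) ℂ)
    (X : MultiOp n d) : replaceSite i φ (siteOp i M * X) = replaceSite i φ (X * siteOp i M) := by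
  ext x y
  simp only [replaceSite, Matrix.of_apply, siteOp_mul_apply, mul_siteOp_apply,
    Function.update_self, Function.update_idem]
  rw [Finset.sum_comm]
  simp only [mul_comm]

/-- The prepared site is uncorrelated with the rest, so its factor splits off. Both the invariance
of later marginals and the endpoint of the telescope follow from this. -/
theorem trace_replaceSite_mul_tensorProductOp {n d : ℕ} (i : Fin n)
    (φ : Matrix (Fin d) (Fin d) ℂ) (X : MultiOp n d) (M : Fin n → Matrix (Fin d) (Fin d) ℂ) :
    (replaceSite i φ X * tensorProductOp M).trace =
      (φ * M i).trace * (X * tensorProductOp (Function.update M i 1)).trace := by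
  have hne : ∀ j : {j : Fin n // j ≠ i}, Function.update M i 1 j = M j :=
    fun j => Function.update_of_ne j.2 _ _
  simp only [Matrix.trace, Matrix.diag, Matrix.mul_apply, sum_eq_sum_glueSite i,
    tensorProductOp_glueSite, replaceSite, Matrix.of_apply, update_glueSite, glueSite_self,
    Function.update_self, hne, Matrix.one_apply, ite_mul, one_mul, zero_mul, mul_ite, mul_zero,
    Finset.sum_ite_eq', Finset.mem_univ, if_true]
  rw [Finset.mul_sum]
  refine Finset.sum_congr rfl fun z _ => ?_
  have h : ∀ f : ({j : Fin n // j ≠ i} → Fin d) → Fin d → ℂ,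
      ∀ g : ({j : Fin n // j ≠ i} → Fin d) → ℂ,
      ∑ x, ∑ w, f w x * g w = ∑ w, (∑ x, f w x) * g w := fun f g => by
    rw [Finset.sum_comm]
    simp only [Finset.sum_mul]
  rw [h, Finset.sum_comm, Finset.mul_sum]
  refine Finset.sum_congr rfl fun w _ => ?_
  rw [Finset.sum_mul]
  refine Finset.sum_congr rfl fun a _ => ?_
  rw [Finset.sum_mul]
  exact Finset.sum_congr rfl fun b _ => by ring

end ReplaceSite

/-! ### Rank-one projections and the block structure of a replacement. -/

section PureState

variable {m : Type*} [Fintype m]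

theorem IsPureState.trace_eq_one {φ : Matrix m m ℂ} (h : IsPureState φ) : φ.trace = 1 := by
  obtain ⟨ψ, h1, rfl⟩ := h
  have h2 := EuclideanSpace.norm_sq_eq ψ
  rw [h1, one_pow] at h2
  simp only [Matrix.trace, Matrix.diag, Matrix.of_apply, Complex.star_def, Complex.mul_conj,
    Complex.normSq_eq_norm_sq]
  exact_mod_cast h2.symm

/-- Rank at most one: all two-by-two minors vanish. -/
theorem IsPureState.mul_apply_mul_apply {φ : Matrix m m ℂ} (h : IsPureState φ) (a b c e : m) :
    φ a b * φ c e = φ a e * φ c b := by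
  obtain ⟨ψ, -, rfl⟩ := h
  simp only [Matrix.of_apply]
  ring

theorem IsPureState.mul_self {φ : Matrix m m ℂ} (h : IsPureState φ) : φ * φ = φ := by
  ext a b
  simp only [Matrix.mul_apply, h.mul_apply_mul_apply a _ _ b, ← Finset.mul_sum]
  rw [show ∑ c, φ c c = 1 from h.trace_eq_one, mul_one]

theorem IsPureState.isHermitian {φ : Matrix m m ℂ} (h : IsPureState φ) : φ.IsHermitian := by
  obtain ⟨ψ, -, rfl⟩ := h
  ext a b
  simp [Matrix.conjTranspose_apply, mul_comm]

/-- A Kraus form: for each basis symbol of the discarded site, take the corresponding block of `X`,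
copied along site `i`, and conjugate it by the diagonal operator with entries `ψ (x i)`. -/
theorem posSemidef_replaceSite {n d : ℕ} (i : Fin n) {φ : Matrix (Fin d) (Fin d) ℂ}
    (hφ : IsPureState φ) {X : MultiOp n d} (hX : X.PosSemidef) :
    (replaceSite i φ X).PosSemidef := by
  obtain ⟨ψ, -, rfl⟩ := hφ
  have e : replaceSite i (Matrix.of fun a b => ψ a * star (ψ b)) X = ∑ a : Fin d,
      Matrix.diagonal (fun x : Fin n → Fin d => ψ (x i)) *
        X.submatrix (fun x => Function.update x i a) (fun x => Function.update x i a) *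
        (Matrix.diagonal fun x : Fin n → Fin d => ψ (x i)).conjTranspose := by
    ext x y
    simp only [Matrix.sum_apply, Matrix.diagonal_conjTranspose, Matrix.mul_diagonal,
      Matrix.diagonal_mul, replaceSite, Matrix.of_apply, Finset.mul_sum, Matrix.submatrix_apply,
      Pi.star_apply]
    exact Finset.sum_congr rfl fun a _ => by ring
  rw [e]
  exact Matrix.posSemidef_sum _ fun a _ => (hX.submatrix _).mul_mul_conjTranspose_same _

/-- Since `φ` has rank one, compressing site `i` by it already leaves a product of `φ` with an
operator on the other sites. -/
theorem replaceSite_siteOp_mul_mul_siteOp {n d : ℕ} (i : Fin n) {φ : Matrix (Fin d) (Fin d) ℂ}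
    (hφ : IsPureState φ) (X : MultiOp n d) :
    replaceSite i φ (siteOp i φ * X * siteOp i φ) = siteOp i φ * X * siteOp i φ := by
  have e : ∀ x y, (siteOp i φ * X * siteOp i φ) x y = φ (x i) (y i) *
      ∑ b, ∑ c, φ b c * X (Function.update x i c) (Function.update y i b) := by
    intro x y
    simp only [mul_siteOp_apply, siteOp_mul_apply, Finset.mul_sum, Finset.sum_mul]
    refine Finset.sum_congr rfl fun b _ => Finset.sum_congr rfl fun c _ => ?_
    have := hφ.mul_apply_mul_apply (x i) c b (y i)
    linear_combination X (Function.update x i c) (Function.update y i b) * this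
  ext x y
  simp only [replaceSite, Matrix.of_apply, e, Function.update_self, Function.update_idem,
    ← Finset.sum_mul]
  rw [show ∑ c, φ c c = 1 from hφ.trace_eq_one, one_mul]

theorem sub_replaceSite_eq {n d : ℕ} (i : Fin n) {φ : Matrix (Fin d) (Fin d) ℂ}
    (hφ : IsPureState φ) (X : MultiOp n d) {P Q : MultiOp n d} (hP : P = siteOp i φ)
    (hQ : Q = 1 - P) :
    X - replaceSite i φ X = P * X * Q + Q * X * P + Q * X * Q - replaceSite i φ (Q * X * Q) := by
  have hPP : P * P = P := by rw [hP, siteOp_mul, hφ.mul_self]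
  have h1 : X = P * X * P + P * X * Q + Q * X * P + Q * X * Q := by
    rw [hQ]; noncomm_ring
  have h2 : replaceSite i φ (P * X * Q) = 0 := by
    rw [mul_assoc, hP, replaceSite_siteOp_mul, ← hP, mul_assoc, hQ, sub_mul, hPP]
    simp [replaceSite_zero]
  have h3 : replaceSite i φ (Q * X * P) = 0 := by
    have h : P * Q = 0 := by rw [hQ, mul_sub, mul_one, hPP, sub_self]
    rw [hP, ← replaceSite_siteOp_mul, ← hP, ← mul_assoc, h, zero_mul, replaceSite_zero]
  have h4 : replaceSite i φ (P * X * P) = P * X * P := by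
    rw [hP, replaceSite_siteOp_mul_mul_siteOp i hφ]
  have h5 : replaceSite i φ X = P * X * P + replaceSite i φ (Q * X * Q) := by
    conv_lhs => rw [h1]
    rw [replaceSite_add, replaceSite_add, replaceSite_add, h2, h3, h4, add_zero, add_zero]
  rw [h5]
  nth_rewrite 1 [h1]
  abel

end PureState

/-! ### The cost of replacing a single site. -/

section Cost

theorem re_trace_nonneg {m : Type*} [Fintype m] {X : Matrix m m ℂ} (hX : X.PosSemidef) :
    X.trace = ((X.trace.re : ℝ) : ℂ) ∧ 0 ≤ X.trace.re := by
  have h := Complex.nonneg_iff.1 hX.trace_nonneg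
  exact ⟨Complex.ext rfl (by simp [← h.2]), h.1⟩

theorem trace_mul_mul_self {m : Type*} [Fintype m] {X P : Matrix m m ℂ} (hP : P * P = P) :
    (P * X * P).trace = (X * P).trace := by
  rw [Matrix.trace_mul_comm, ← mul_assoc, hP, Matrix.trace_mul_comm]

/-- Replacing one site of a state by a pure state whose overlap with the marginal is `q`. -/
theorem exists_decomposition_sub_replaceSite {n d : ℕ} (i : Fin n)
    {φ : Matrix (Fin d) (Fin d) ℂ} (hφ : IsPureState φ) {ρ : MultiOp n d}
    (hρ : IsDensityMatrix ρ) {t : ℝ} (ht : 0 < t) {q : ℝ} (hq : (ρ * siteOp i φ).trace.re = q) :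
    0 ≤ q ∧ q ≤ 1 ∧ ∃ τ η : MultiOp n d, IsDensityMatrix τ ∧ IsDensityMatrix η ∧
      traceOut i τ = traceOut i η ∧
      ρ - replaceSite i φ ρ = (((t * q + (1 - q) / t) / 2 + (1 - q) : ℝ) : ℂ) • (τ - η) := by
  obtain ⟨P, hP⟩ : ∃ P : MultiOp n d, P = siteOp i φ := ⟨_, rfl⟩
  obtain ⟨Q, hQ⟩ : ∃ Q : MultiOp n d, Q = 1 - P := ⟨_, rfl⟩
  have hPP : P * P = P := by rw [hP, siteOp_mul, hφ.mul_self]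
  have hPQ : P * Q = 0 := by rw [hQ, mul_sub, mul_one, hPP, sub_self]
  have hQP : Q * P = 0 := by rw [hQ, sub_mul, one_mul, hPP, sub_self]
  have hQQ : Q * Q = Q := by nth_rewrite 2 [hQ]; rw [mul_sub, mul_one, hQP, sub_zero]
  have hPh : P.conjTranspose = P := by rw [hP, conjTranspose_siteOp, hφ.isHermitian.eq]
  have hQh : Q.conjTranspose = Q := by
    rw [hQ, Matrix.conjTranspose_sub, Matrix.conjTranspose_one, hPh]
  have hPX : (P * ρ * P).PosSemidef := by
    have := hρ.1.mul_mul_conjTranspose_same P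
    rwa [hPh] at this
  have hQX : (Q * ρ * Q).PosSemidef := by
    have := hρ.1.mul_mul_conjTranspose_same Q
    rwa [hQh] at this
  have hPt : (ρ * P).trace = (q : ℂ) := by
    have := (re_trace_nonneg hPX).1
    rwa [trace_mul_mul_self hPP, show (ρ * P).trace.re = q by rw [hP, hq]] at this
  have hQt : (ρ * Q).trace = ((1 - q : ℝ) : ℂ) := by
    rw [hQ, mul_sub, mul_one, Matrix.trace_sub, hρ.2, hPt]
    push_cast
    rfl
  have hq0 : 0 ≤ q := by
    have := (re_trace_nonneg hPX).2
    rwa [trace_mul_mul_self hPP, hPt, Complex.ofReal_re] at this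
  have hq1 : 0 ≤ 1 - q := by
    have := (re_trace_nonneg hQX).2
    rwa [trace_mul_mul_self hQQ, hQt, Complex.ofReal_re] at this
  refine ⟨hq0, by linarith, ?_⟩
  -- `c` is the common trace of the positive operators `A` and `B` below. It must be nonzero because
  -- they are normalised by it.
  obtain ⟨c, hc⟩ : ∃ c : ℝ, c = (t * q + (1 - q) / t) / 2 + (1 - q) := ⟨_, rfl⟩
  rw [← hc]
  have hc0 : 0 < c := by
    have h1 : 0 ≤ (1 - q) / t := div_nonneg hq1 ht.le
    rcases hq0.eq_or_lt with h | h
    · have : 0 ≤ t * q := mul_nonneg ht.le hq0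
      rw [hc]
      linarith
    · have : 0 < t * q := mul_pos ht h
      rw [hc]
      linarith
  have htc : (t : ℂ) ≠ 0 := by exact_mod_cast ht.ne'
  have hcc : (c : ℂ) ≠ 0 := by exact_mod_cast hc0.ne'
  have hs : (0 : ℂ) ≤ ((2 * t)⁻¹ : ℝ) := by
    have : 0 ≤ (2 * t)⁻¹ := by positivity
    exact_mod_cast this
  have hsand : ∀ s : ℝ, (((t : ℂ) • P + (s : ℂ) • Q) * ρ * ((t : ℂ) • P + (s : ℂ) • Q)).PosSemidef
      := by
    intro s
    have := hρ.1.mul_mul_conjTranspose_same ((t : ℂ) • P + (s : ℂ) • Q)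
    rwa [Matrix.conjTranspose_add, Matrix.conjTranspose_smul, Matrix.conjTranspose_smul, hPh, hQh,
      Complex.star_def, Complex.conj_ofReal, Complex.conj_ofReal] at this
  -- Polarisation: `(tP + Q) ρ (tP + Q)` minus `(tP - Q) ρ (tP - Q)` is `2t (PρQ + QρP)`, whence the
  -- factor `(2t)⁻¹`. The last summands of `A` and `B` carry the remaining part of `ρ - replaceSite
  -- i φ ρ`.
  obtain ⟨A, hA⟩ : ∃ A, A = (((2 * t)⁻¹ : ℝ) : ℂ) • (((t : ℂ) • P + ((1 : ℝ) : ℂ) • Q) * ρ *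
    ((t : ℂ) • P + ((1 : ℝ) : ℂ) • Q)) + Q * ρ * Q := ⟨_, rfl⟩
  obtain ⟨B, hB⟩ : ∃ B, B = (((2 * t)⁻¹ : ℝ) : ℂ) • (((t : ℂ) • P + ((-1 : ℝ) : ℂ) • Q) * ρ *
    ((t : ℂ) • P + ((-1 : ℝ) : ℂ) • Q)) + replaceSite i φ (Q * ρ * Q) := ⟨_, rfl⟩
  have hAp : A.PosSemidef := by
    rw [hA]
    exact ((hsand 1).smul hs).add hQX
  have hBp : B.PosSemidef := by
    rw [hB]
    exact ((hsand (-1)).smul hs).add (posSemidef_replaceSite i hφ hQX)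
  have hexp : ∀ s : ℂ, ((t : ℂ) • P + s • Q) * ρ * ((t : ℂ) • P + s • Q) =
      ((t : ℂ) * t) • (P * ρ * P) + ((t : ℂ) * s) • (P * ρ * Q + Q * ρ * P) +
        (s * s) • (Q * ρ * Q) := by
    intro s
    simp only [add_mul, mul_add, Matrix.smul_mul, Matrix.mul_smul, smul_smul, smul_add]
    rw [mul_comm s (t : ℂ)]
    abel
  have hAB : ρ - replaceSite i φ ρ = A - B := by
    rw [sub_replaceSite_eq i hφ ρ hP hQ, hA, hB, hexp, hexp]
    have e : (((2 * t)⁻¹ : ℝ) : ℂ) * (2 * t) = 1 := by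
      push_cast
      field_simp
    have e2 : P * ρ * Q + Q * ρ * P = ((((2 * t)⁻¹ : ℝ) : ℂ) * (2 * t)) •
        (P * ρ * Q + Q * ρ * P) := by rw [e, one_smul]
    rw [Complex.ofReal_neg, Complex.ofReal_one]
    linear_combination (norm := module) e2
  have hAt : A.trace = c := by
    have h1 : (P * ρ * Q).trace = 0 := by
      rw [Matrix.trace_mul_comm, ← mul_assoc, hQP, zero_mul, Matrix.trace_zero]
    have h2 : (Q * ρ * P).trace = 0 := by
      rw [Matrix.trace_mul_comm, ← mul_assoc, hPQ, zero_mul, Matrix.trace_zero]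
    rw [hA, hexp]
    simp only [Matrix.trace_add, Matrix.trace_smul, h1, h2, trace_mul_mul_self hPP,
      trace_mul_mul_self hQQ, hPt, hQt, hc, smul_eq_mul]
    push_cast
    field_simp
    ring
  -- Replacement preserves the partial trace over site `i`, so `A - B` has partial trace zero.
  have hout : traceOut i A = traceOut i B := by
    have h1 := traceOut_replaceSite i hφ.trace_eq_one ρ
    rw [sub_eq_sub_iff_add_eq_add] at hAB
    have h2 : ∀ X Y : MultiOp n d, traceOut i (X + Y) = traceOut i X + traceOut i Y := by
      intro X Y
      ext z w
      simp [traceOut, Finset.sum_add_distrib]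
    have h3 := congrArg (traceOut i) hAB
    rw [h2, h2, h1, add_comm] at h3
    exact (add_right_cancel h3).symm
  have hBt : B.trace = c := by
    rw [trace_eq_trace_traceOut i, ← hout, ← trace_eq_trace_traceOut, hAt]
  have hcinv : (0 : ℂ) ≤ (c : ℂ)⁻¹ := by
    have : 0 ≤ c⁻¹ := inv_nonneg.2 hc0.le
    exact_mod_cast this
  have hsmul : ∀ X : MultiOp n d, traceOut i ((c : ℂ)⁻¹ • X) = (c : ℂ)⁻¹ • traceOut i X := by
    intro X
    ext z w
    simp [traceOut, Finset.mul_sum]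
  refine ⟨(c : ℂ)⁻¹ • A, (c : ℂ)⁻¹ • B, ⟨hAp.smul hcinv, ?_⟩, ⟨hBp.smul hcinv, ?_⟩, ?_, ?_⟩
  · rw [Matrix.trace_smul, hAt, smul_eq_mul, inv_mul_cancel₀ hcc]
  · rw [Matrix.trace_smul, hBt, smul_eq_mul, inv_mul_cancel₀ hcc]
  · rw [hsmul, hsmul, hout]
  · rw [← smul_sub, smul_smul, mul_inv_cancel₀ hcc, one_smul, hAB]

end Cost

/-! ### Telescoping from `ρ` to the product state. -/

section Telescope

/-- The state obtained by replacing the first `k` sites by the states `φ 0, …, φ (k - 1)`. -/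
noncomputable def replaceFirst {n d : ℕ} (φ : Fin n → Matrix (Fin d) (Fin d) ℂ) (ρ : MultiOp n d) :
    ℕ → MultiOp n d
  | 0 => ρ
  | k + 1 => if h : k < n then replaceSite ⟨k, h⟩ (φ ⟨k, h⟩) (replaceFirst φ ρ k)
      else replaceFirst φ ρ k

variable {n d : ℕ} {φ : Fin n → Matrix (Fin d) (Fin d) ℂ} {ρ : MultiOp n d}

theorem isDensityMatrix_replaceFirst (hφ : ∀ i, IsPureState (φ i)) (hρ : IsDensityMatrix ρ)
    (k : ℕ) : IsDensityMatrix (replaceFirst φ ρ k) := by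
  induction k with
  | zero => exact hρ
  | succ k ih =>
    rw [replaceFirst]
    split
    · exact ⟨posSemidef_replaceSite _ (hφ _) ih.1,
        by rw [trace_replaceSite _ (hφ _).trace_eq_one, ih.2]⟩
    · exact ih

/-- Only sites before `i` have been replaced when `k ≤ i`, and each replacement preserves
expectations of observables supported elsewhere. -/
theorem trace_replaceFirst_mul_siteOp (hφ : ∀ i, IsPureState (φ i)) (i : Fin n)
    (M : Matrix (Fin d) (Fin d) ℂ) {k : ℕ} (hk : k ≤ i) :
    (replaceFirst φ ρ k * siteOp i M).trace = (ρ * siteOp i M).trace := by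
  induction k with
  | zero => rfl
  | succ k ih =>
    have hkn : k < n := by omega
    have hne : (⟨k, hkn⟩ : Fin n) ≠ i := by
      rintro rfl
      simp at hk
    rw [← ih (by omega), replaceFirst, dif_pos hkn, siteOp, trace_replaceSite_mul_tensorProductOp,
      Function.update_of_ne hne, mul_one, (hφ _).trace_eq_one, one_mul]
    congr 3
    rw [Function.update_eq_self_iff, Function.update_of_ne hne]

/-- Keeping the observable trivial on the sites not yet replaced makes the induction close:
splitting off site `k` turns the observable for `k + 1` into the one for `k`. At `k = n` every
product observable is covered. -/
theorem trace_replaceFirst_mul_tensorProductOp (hφ : ∀ i, IsPureState (φ i))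
    (hρ : IsDensityMatrix ρ) (M : Fin n → Matrix (Fin d) (Fin d) ℂ) (k : ℕ) (hk : k ≤ n) :
    (replaceFirst φ ρ k * tensorProductOp fun j => if (j : ℕ) < k then M j else 1).trace =
      ∏ j, (φ j * if (j : ℕ) < k then M j else 1).trace := by
  induction k with
  | zero => simp [replaceFirst, tensorProductOp_one, hρ.2, (hφ _).trace_eq_one]
  | succ k ih =>
    have hkn : k < n := hk
    have e : Function.update (fun j : Fin n => if (j : ℕ) < k + 1 then M j else 1) ⟨k, hkn⟩ 1 =
        fun j : Fin n => if (j : ℕ) < k then M j else 1 := by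
      funext j
      by_cases h : j = ⟨k, hkn⟩
      · subst h; simp
      · have h2 : (j : ℕ) ≠ k := fun h3 => h (Fin.ext h3)
        rw [Function.update_of_ne h]
        congr 1
        simp only [eq_iff_iff]
        omega
    rw [replaceFirst, dif_pos hkn, trace_replaceSite_mul_tensorProductOp, e, ih hkn.le,
      Fintype.prod_eq_mul_prod_subtype_ne _ (⟨k, hkn⟩ : Fin n),
      Fintype.prod_eq_mul_prod_subtype_ne (fun j : Fin n =>
        (φ j * if (j : ℕ) < k + 1 then M j else 1).trace) (⟨k, hkn⟩ : Fin n)]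
    simp only [lt_irrefl, if_false, mul_one, (hφ _).trace_eq_one, one_mul]
    congr 1
    refine Finset.prod_congr rfl fun j _ => ?_
    rw [← congrFun e j, Function.update_of_ne j.2]

theorem replaceFirst_eq_tensorProductOp (hφ : ∀ i, IsPureState (φ i)) (hρ : IsDensityMatrix ρ) :
    replaceFirst φ ρ n = tensorProductOp φ := by
  refine eq_of_trace_mul_tensorProductOp fun M => ?_
  have h := trace_replaceFirst_mul_tensorProductOp hφ hρ M n le_rfl
  simp only [Fin.is_lt, if_true] at h
  rw [h, tensorProductOp_mul, trace_tensorProductOp]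

theorem sub_tensorProductOp_eq_sum (hφ : ∀ i, IsPureState (φ i)) (hρ : IsDensityMatrix ρ) :
    ρ - tensorProductOp φ =
      ∑ i : Fin n, (replaceFirst φ ρ i - replaceSite i (φ i) (replaceFirst φ ρ i)) := by
  have h := Finset.sum_range_sub' (replaceFirst φ ρ) n
  rw [replaceFirst_eq_tensorProductOp hφ hρ] at h
  change _ = ρ - _ at h
  rw [← h, Finset.sum_range]
  refine Finset.sum_congr rfl fun i _ => ?_
  rw [replaceFirst, dif_pos i.2]

end Telescope

/-! ### Averaging over sites, optimising `t`, and comparison with the entropy. -/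

section Bound

variable {n d : ℕ} {φ : Fin n → Matrix (Fin d) (Fin d) ℂ} {ρ : MultiOp n d}

theorem overlap_mem_Icc (hφ : ∀ i, IsPureState (φ i)) (hρ : IsDensityMatrix ρ) (i : Fin n) :
    (marginal i ρ * φ i).trace.re ∈ Set.Icc (0 : ℝ) 1 := by
  rw [← trace_mul_siteOp]
  obtain ⟨h0, h1, -⟩ := exists_decomposition_sub_replaceSite i (hφ i) hρ one_pos rfl
  exact ⟨h0, h1⟩

theorem natCast_mul_avgInfidelity (hn : 1 ≤ n) :
    (n : ℝ) * avgInfidelity ρ φ = ∑ i, (1 - (marginal i ρ * φ i).trace.re) := by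
  have : (n : ℝ) ≠ 0 := by positivity
  rw [avgInfidelity]
  field_simp

theorem avgInfidelity_mem_Icc (hn : 1 ≤ n) (hφ : ∀ i, IsPureState (φ i))
    (hρ : IsDensityMatrix ρ) : avgInfidelity ρ φ ∈ Set.Icc (0 : ℝ) 1 := by
  have hn' : (0 : ℝ) < n := by positivity
  have h := natCast_mul_avgInfidelity (ρ := ρ) (φ := φ) hn
  have h0 : 0 ≤ ∑ i, (1 - (marginal i ρ * φ i).trace.re) :=
    Finset.sum_nonneg fun i _ => sub_nonneg.2 (overlap_mem_Icc hφ hρ i).2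
  have h1 : ∑ i, (1 - (marginal i ρ * φ i).trace.re) ≤ ∑ _ : Fin n, (1 : ℝ) :=
    Finset.sum_le_sum fun i _ => by linarith [(overlap_mem_Icc hφ hρ i).1]
  rw [← h] at h0 h1
  simp only [Finset.sum_const, Finset.card_univ, Fintype.card_fin, nsmul_eq_mul] at h1
  exact ⟨nonneg_of_mul_nonneg_right h0 hn', le_of_mul_le_mul_left h1 hn'⟩

theorem wassersteinDist_tensorProductOp_le (hn : 1 ≤ n) (hφ : ∀ i, IsPureState (φ i))
    (hρ : IsDensityMatrix ρ) {t : ℝ} (ht : 0 < t) :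
    (1 / (n : ℝ)) * wassersteinDist ρ (tensorProductOp φ) ≤
      (t * (1 - avgInfidelity ρ φ) + avgInfidelity ρ φ / t) / 2 + avgInfidelity ρ φ := by
  have hn' : (0 : ℝ) < n := by positivity
  have hstep : ∀ i : Fin n, (replaceFirst φ ρ i * siteOp i (φ i)).trace.re =
      (marginal i ρ * φ i).trace.re := fun i => by
    rw [trace_replaceFirst_mul_siteOp hφ i _ le_rfl, trace_mul_siteOp]
  choose h0 h1 τ η hτ hη hout heq using fun i : Fin n =>
    exists_decomposition_sub_replaceSite i (hφ i) (isDensityMatrix_replaceFirst hφ hρ i) ht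
      (hstep i)
  have hle : wassersteinDist ρ (tensorProductOp φ) ≤
      ∑ i, ((t * (marginal i ρ * φ i).trace.re + (1 - (marginal i ρ * φ i).trace.re) / t) / 2 +
        (1 - (marginal i ρ * φ i).trace.re)) := by
    refine csInf_le ⟨0, ?_⟩ ⟨_, τ, η, fun i => ?_, fun i => ⟨hτ i, hη i, hout i⟩, ?_, rfl⟩
    · rintro w ⟨c, τ, η, hc, -, -, rfl⟩
      exact Finset.sum_nonneg fun i _ => hc i
    · have h2 := sub_nonneg.2 (h1 i)
      have h3 := h0 i
      positivity
    · rw [sub_tensorProductOp_eq_sum hφ hρ]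
      exact Finset.sum_congr rfl fun i _ => heq i
  have hsum : ∑ i, ((t * (marginal i ρ * φ i).trace.re +
      (1 - (marginal i ρ * φ i).trace.re) / t) / 2 + (1 - (marginal i ρ * φ i).trace.re)) =
      n * ((t * (1 - avgInfidelity ρ φ) + avgInfidelity ρ φ / t) / 2 + avgInfidelity ρ φ) := by
    -- The cost is affine in `1 - q`, so the sum over sites depends on the infidelities only through
    -- their average.
    have e : ∀ q : ℝ, (t * q + (1 - q) / t) / 2 + (1 - q) =
        t / 2 + (1 - q) * (-t / 2 + 1 / t / 2 + 1) := fun q => by ring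
    simp only [e, Finset.sum_add_distrib, ← Finset.sum_mul, ← natCast_mul_avgInfidelity hn,
      Finset.sum_const, Finset.card_univ, Fintype.card_fin, nsmul_eq_mul]
    ring
  rw [hsum] at hle
  rw [one_div, inv_mul_le_iff₀ hn']
  exact hle

/-- The arithmetic-geometric mean bound is attained at `t = √(p / (1 - p))`. At `p = 0` and `p = 1`
this degenerates, and the infimum is only approached as `t` tends to zero or infinity; hence the
slack `ε`. -/
theorem le_sqrt_mul_of_forall_pos {w p : ℝ} (hp : p ∈ Set.Icc (0 : ℝ) 1)
    (h : ∀ t : ℝ, 0 < t → w ≤ (t * (1 - p) + p / t) / 2) : w ≤ √(p * (1 - p)) := by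
  obtain ⟨hp0, hp1⟩ := hp
  refine le_of_forall_pos_le_add fun ε hε => ?_
  rcases hp0.eq_or_lt with rfl | hp0
  · have := h ε hε
    simp only [sub_zero, mul_one, zero_div, add_zero, Real.sqrt_zero, zero_add] at this ⊢
    linarith
  rcases hp1.eq_or_lt with rfl | hp1
  · have := h ε⁻¹ (inv_pos.2 hε)
    simp only [sub_self, mul_zero, div_inv_eq_mul, one_mul, zero_add, Real.sqrt_zero] at this ⊢
    linarith
  have hq : 0 < 1 - p := sub_pos.2 hp1
  have hs : 0 < √(p * (1 - p)) := Real.sqrt_pos.2 (mul_pos hp0 hq)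
  have hss : √(p * (1 - p)) * √(p * (1 - p)) = p * (1 - p) :=
    Real.mul_self_sqrt (mul_pos hp0 hq).le
  have := h (√(p * (1 - p)) / (1 - p)) (div_pos hs hq)
  have e : (√(p * (1 - p)) / (1 - p) * (1 - p) + p / (√(p * (1 - p)) / (1 - p))) / 2 =
      √(p * (1 - p)) := by
    rw [div_mul_cancel₀ _ hq.ne', div_div_eq_mul_div, (div_eq_iff hs.ne').2 hss.symm]
    ring
  linarith

/-- From `log x ≤ x - 1`, each of the two entropy terms is at least `x (1 - x)`, at `x = p` and at
`x = 1 - p`. -/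
theorem two_mul_mul_le_binEntropy {p : ℝ} (hp : p ∈ Set.Icc (0 : ℝ) 1) :
    2 * (p * (1 - p)) ≤ Real.binEntropy p := by
  obtain ⟨hp0, hp1⟩ := hp
  have key : ∀ x : ℝ, 0 ≤ x → x * (1 - x) ≤ Real.negMulLog x := by
    intro x hx
    rcases hx.eq_or_lt with rfl | hx
    · simp
    · have := Real.log_le_sub_one_of_pos hx
      rw [Real.negMulLog]
      nlinarith
  have h1 := key p hp0
  have h2 := key (1 - p) (sub_nonneg.2 hp1)
  rw [Real.binEntropy_eq_negMulLog_add_negMulLog_one_sub]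
  linarith

end Bound

theorem mainTheorem2 {n d : ℕ} (hn : 1 ≤ n)
    (φ : Fin n → Matrix (Fin d) (Fin d) ℂ) (hφ : ∀ i, IsPureState (φ i))
    (ρ : MultiOp n d) (hρ : IsDensityMatrix ρ) :
    (1 / (n : ℝ)) * wassersteinDist ρ (tensorProductOp φ) ≤
      √((Real.binEntropy (avgInfidelity ρ φ)
          + avgInfidelity ρ φ * Real.log ((d : ℝ) - 1)) / 2)
        + avgInfidelity ρ φ := by
  have hp := avgInfidelity_mem_Icc hn hφ hρ
  have h1 := le_sqrt_mul_of_forall_pos hp fun t ht =>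
    sub_le_iff_le_add.2 (wassersteinDist_tensorProductOp_le hn hφ hρ ht)
  -- For `d = 0` and `d = 1` the arguments are `-1` and `0`, where `Real.log` takes the value `0`.
  have hlog : 0 ≤ Real.log ((d : ℝ) - 1) := by
    match d with
    | 0 => simp
    | 1 => simp
    | d + 2 =>
      refine Real.log_nonneg ?_
      push_cast
      linarith [Nat.cast_nonneg (α := ℝ) d]
  have h2 := two_mul_mul_le_binEntropy hp
  have h3 := mul_nonneg hp.1 hlog
  have h4 : √(avgInfidelity ρ φ * (1 - avgInfidelity ρ φ)) ≤ √((Real.binEntropy (avgInfidelity ρ φ)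
      + avgInfidelity ρ φ * Real.log ((d : ℝ) - 1)) / 2) := Real.sqrt_le_sqrt (by linarith)
  linarith
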